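/- Let $\mathbb K\in\{\mathbb R,\mathbb C\}$. For a map $\Psi\colon X\to C(K;\mathbb K)$ from a set $X$ into the space of continuous functions on a compact Hausdorff space $K$, and $1\le p<\infty$, a map $u$ from $X$ to a metric space $Y$ is called $\Psi$-Lipschitz $p$-summing if there is $C\ge 0$ with $$\Big(\sum_{j=1}^m d_Y(u(x_j),u(q_j))^p\Big)^{1/p}\le C\sup_{\varphi\in K}\Big(\sum_{j=1}^m|\Psi(x_j)(\varphi)-\Psi(q_j)(\varphi)|^p\Big)^{1/p}$$ for all $m\in\mathbb N$ and $x_1,\dots,x_m,q_1,\dots,q_m\in X$. A metric space $Z$ is an absolute Lipschitz retract if it is a Lipschitz retract of every metric space that contains it isometrically. For a pointed metric space $(X,x_0)$ let $B_{X^\#}$ be the set of all $1$-Lipschitz functions $f\colon X\to\mathbb R$ with $f(x_0)=0$, a compact Hausdorff space under pointwise convergence, and let $\Psi_X\colon X\to C(B_{X^\#};\mathbb K)$, $\Psi_X(x)(f)=f(x)$. For a regular Borel probability measure $\mu$ on $B_{X^\#}$ let $j_{p}\colon C(B_{X^\#};\mathbb K)\to L_p(B_{X^\#},\mu)$ be the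 canonical map. **Proposition.** Let $1\le p<\infty$. There are a pointed metric space $(X,x_0)$, a Banach space $Y$ over $\mathbb K$ and a $\Psi_X$-Lipschitz $p$-summing map $u\colon X\to Y$ with $u(x_0)=0$ such that the following holds. 1. There is a Banach space over $\mathbb K$ that is an absolute Lipschitz retract and into which $Y$ embeds linearly and isometrically. 2. There is a regular Borel probability measure $\mu_0$ on $B_{X^\#}$ such that for every Banach space $Z$ over $\mathbb K$ that is an absolute Lipschitz retract and every linear isometric embedding $J\colon Y\to Z$: (i) there is a Lipschitz map $B\colon L_p(B_{X^\#},\mu_0)\to Z$ with $B\circ j_p\circ\Psi_X=J\circ u$; (ii) for no regular Borel probability measure $\mu$ on $B_{X^\#}$ is there a Lipschitz map $B\colon L_p(B_{X^\#},\mu)\to Z$ that is linear and satisfies $B\circ j_p\circ\Psi_X=J\circ u$. Hence, in the factorization $B\circ j_p\circ\Psi=J\circ u$ of a $\Psi$-Lipschitz $p$-summing map $u$ through $L_p(K,\mu)$, the Lipschitz map $B$ cannot in general be chosen linear, even when $Y$ and $Z$ are Banach spaces and $J$ is a linear isometric embedding. -/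

import Mathlib

open MeasureTheory
open scoped NNReal ENNReal

/-- `Z` is an absolute Lipschitz retract: whenever `Z` sits isometrically inside a metric space `W`,
there is a Lipschitz retraction of `W` onto `Z`. -/
def IsAbsoluteLipschitzRetract.{u} (Z : Type u) [MetricSpace Z] : Prop :=
  ∀ (W : Type u) [MetricSpace W] (i : Z → W), Isometry i →
    ∃ (C : ℝ≥0) (r : W → Z), LipschitzWith C r ∧ ∀ z, r (i z) = z

/-- `u : X → Y` is `Ψ`-Lipschitz `p`-summing, where `Ψ : X → C(K)` is an arbitrary map:
`(∑ d(u xⱼ, u qⱼ)^p)^(1/p) ≤ C sup_{φ ∈ K} (∑ |Ψ(xⱼ)(φ) - Ψ(qⱼ)(φ)|^p)^(1/p)`. -/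
def IsLipschitzSumming {𝕜 X Y K : Type*} [RCLike 𝕜] [MetricSpace Y] [TopologicalSpace K]
    (Ψ : X → C(K, 𝕜)) (p : ℝ≥0∞) (u : X → Y) : Prop :=
  ∃ C : ℝ, 0 ≤ C ∧ ∀ (m : ℕ) (x q : Fin m → X),
    (∑ j, dist (u (x j)) (u (q j)) ^ p.toReal) ^ (1 / p.toReal) ≤
      C * ⨆ φ : K, (∑ j, ‖Ψ (x j) φ - Ψ (q j) φ‖ ^ p.toReal) ^ (1 / p.toReal)

/-- The closed unit ball `B_{X^#}` of the space `X^#` of real-valued Lipschitz functions on the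
pointed metric space `(X, x₀)` that vanish at `x₀`, normed by the least Lipschitz constant. -/
def LipBall {X : Type*} [MetricSpace X] (x₀ : X) : Type _ :=
  {f : X → ℝ // LipschitzWith 1 f ∧ f x₀ = 0}

namespace LipBall

variable {X : Type*} [MetricSpace X] (x₀ : X)

/-- The topology of pointwise convergence. -/
instance : TopologicalSpace (LipBall x₀) :=
  inferInstanceAs (TopologicalSpace {f : X → ℝ // LipschitzWith 1 f ∧ f x₀ = 0})

instance : T2Space (LipBall x₀) :=
  inferInstanceAs (T2Space {f : X → ℝ // LipschitzWith 1 f ∧ f x₀ = 0})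

theorem isCompact_setOf : IsCompact {f : X → ℝ | LipschitzWith 1 f ∧ f x₀ = 0} := by
  refine (isCompact_univ_pi fun x => isCompact_closedBall (0 : ℝ) (dist x x₀)).of_isClosed_subset
    ?_ ?_
  · have h : {f : X → ℝ | LipschitzWith 1 f ∧ f x₀ = 0} =
        (⋂ x, ⋂ y, {f : X → ℝ | dist (f x) (f y) ≤ dist x y}) ∩ {f | f x₀ = 0} := by
      ext f
      simp [lipschitzWith_iff_dist_le_mul]
    rw [h]
    refine (isClosed_iInter fun x => isClosed_iInter fun y => ?_).inter ?_
    · exact isClosed_le (by fun_prop) continuous_const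
    · exact isClosed_eq (by fun_prop) continuous_const
  · rintro f ⟨hf, h0⟩ x -
    have := hf.dist_le_mul x x₀
    simpa [h0] using this

instance : CompactSpace (LipBall x₀) :=
  isCompact_iff_compactSpace.mp (isCompact_setOf x₀)

instance : MeasurableSpace (LipBall x₀) := borel _

instance : BorelSpace (LipBall x₀) := ⟨rfl⟩

end LipBall

/-- The evaluation map `Ψ : X → C(B_{X^#}; 𝕜)`, `Ψ(x)(f) = f(x)`. -/
def lipEval (𝕜 : Type*) [RCLike 𝕜] {X : Type*} [MetricSpace X] (x₀ : X) (x : X) :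
    C(LipBall x₀, 𝕜) where
  toFun f := ((f.1 x : ℝ) : 𝕜)
  continuous_toFun := RCLike.continuous_ofReal.comp ((continuous_apply x).comp continuous_subtype_val)

/-- The diagram `B ∘ j_p ∘ Ψ = J ∘ u` commutes, where `j_p : C(K) → L_p(K, μ)` is canonical. -/
def ClosesDiagram {𝕜 X Y Z K : Type*} [RCLike 𝕜] [TopologicalSpace K] [CompactSpace K]
    [MeasurableSpace K] [BorelSpace K] (Ψ : X → C(K, 𝕜)) (p : ℝ≥0∞) [Fact (1 ≤ p)]
    (μ : Measure K) [IsFiniteMeasure μ] (u : X → Y) (J : Y → Z) (B : Lp 𝕜 p μ → Z) : Prop :=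
  ∀ x, B (ContinuousMap.toLp p μ 𝕜 (Ψ x)) = J (u x)

/-! Take countably many points at mutual distance one and let `u` send the base point to 0 and the
`n`-th other point to the `n`-th sign function in ℓ∞ over all sign sequences. Under the law of fair
coin flips (`flipMeasure`), distinct evaluations are at least 1/4 apart in `L_p`, while the values
of `u` are at most 2 apart. Hence `J ∘ u` is Lipschitz for the `L_p` metric, and the retract
property extends it to all of `L_p`. Linearity fails because sign functions behave like the ℓ¹
basis: every signed sum of `N` of them has norm at least `N`. For any probability measure, suitable
signs give the sum of `N` evaluations an `L_2` norm at most `√N`, hence an `L_p` norm of order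
`o(N)` (`exists_signs_norm_toLp_le`). A bounded linear `B` cannot send the second sum to the first
for all `N`. -/

/-! ### Absolute Lipschitz retracts and extension of Lipschitz maps. -/

/-- Kuratowski embedding; subtracting `dist z₀ a` makes the functions bounded. The index set `Z`
keeps the target in the universe over which `IsAbsoluteLipschitzRetract` quantifies. -/
theorem exists_isometry_lp_infty.{w} (Z : Type w) [MetricSpace Z] [Nonempty Z] :
    ∃ i : Z → lp (fun _ : Z => ℝ) ∞, Isometry i := by
  obtain ⟨z₀⟩ := ‹Nonempty Z›
  refine ⟨fun z => ⟨fun a => dist z a - dist z₀ a, memℓp_infty ⟨dist z z₀, ?_⟩⟩,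
    Isometry.of_dist_eq fun x y => ?_⟩
  · rintro _ ⟨a, rfl⟩
    exact abs_dist_sub_le z z₀ a
  · rw [dist_eq_norm]
    refine le_antisymm (lp.norm_le_of_forall_le dist_nonneg fun a => ?_) ?_
    · change |dist x a - dist z₀ a - (dist y a - dist z₀ a)| ≤ dist x y
      rw [sub_sub_sub_cancel_right]
      exact abs_dist_sub_le x y a
    · refine le_trans ?_ (lp.norm_apply_le_norm ENNReal.top_ne_zero _ y)
      change dist x y ≤ |dist x y - dist z₀ y - (dist y y - dist z₀ y)|
      rw [sub_sub_sub_cancel_right, dist_self, sub_zero]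
      exact le_abs_self _

/-- Lipschitz maps into an absolute Lipschitz retract extend from subsets. -/
theorem IsAbsoluteLipschitzRetract.exists_extension.{v, w} {Z : Type w} [MetricSpace Z]
    [Nonempty Z] (hZ : IsAbsoluteLipschitzRetract Z) {E : Type v} [PseudoMetricSpace E]
    {s : Set E} {f : E → Z} {K : ℝ≥0} (hf : LipschitzOnWith K f s) :
    ∃ g : E → Z, (∃ C : ℝ≥0, LipschitzWith C g) ∧ Set.EqOn f g s := by
  obtain ⟨i, hi⟩ := exists_isometry_lp_infty Z
  obtain ⟨C, r, hr, hri⟩ := hZ _ i hi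
  obtain ⟨g, hg, hgs⟩ := (hi.lipschitz.comp_lipschitzOnWith hf).extend_lp_infty
  refine ⟨r ∘ g, ⟨_, hr.comp hg⟩, fun x hx => ?_⟩
  rw [Function.comp_apply, ← hgs hx, Function.comp_apply, hri]

/-- Real and imaginary parts of each coordinate are 1-Lipschitz on the image of `i` and extend by
McShane; adding the two gives the constant 2. -/
theorem isAbsoluteLipschitzRetract_lp_infty {𝕜 ι : Type*} [RCLike 𝕜] :
    IsAbsoluteLipschitzRetract (lp (fun _ : ι => 𝕜) ∞) := by
  intro W _ i hi
  have : Nonempty (lp (fun _ : ι => 𝕜) ∞) := ⟨0⟩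
  let z := fun w => Function.invFun i w
  have hz : ∀ y, z (i y) = y := Function.leftInverse_invFun hi.injective
  have key : ∀ L : 𝕜 → ℝ, (∀ x y, |L x - L y| ≤ ‖x - y‖) → ∀ a : ι,
      ∃ g : W → ℝ, LipschitzWith 1 g ∧ ∀ y : lp (fun _ : ι => 𝕜) ∞, g (i y) = L (y a) := by
    intro L hL a
    have : LipschitzOnWith 1 (fun w => L (z w a)) (Set.range i) := by
      refine LipschitzOnWith.of_dist_le_mul ?_
      rintro _ ⟨x, rfl⟩ _ ⟨y, rfl⟩
      rw [hz, hz, hi.dist_eq, dist_eq_norm x y, NNReal.coe_one, one_mul]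
      exact (hL _ _).trans (lp.norm_apply_le_norm ENNReal.top_ne_zero (x - y) a)
    obtain ⟨g, hg, hgi⟩ := this.extend_real
    exact ⟨g, hg, fun y => by rw [← hgi ⟨y, rfl⟩]; simp only [hz]⟩
  choose g hg hgi using key RCLike.re fun x y => by
    rw [← map_sub]; exact RCLike.abs_re_le_norm _
  choose h hh hhi using key RCLike.im fun x y => by
    rw [← map_sub]; exact RCLike.abs_im_le_norm _
  let G : W → ι → 𝕜 := fun w a => (g a w : 𝕜) + (h a w : 𝕜) * RCLike.I
  have hGi : ∀ y : lp (fun _ : ι => 𝕜) ∞, ∀ a, G (i y) a = y a := fun y a => by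
    simp only [G, hgi, hhi, RCLike.re_add_im]
  have hGd : ∀ w w' a, ‖G w a - G w' a‖ ≤ 2 * dist w w' := fun w w' a => by
    have e : G w a - G w' a =
        ((g a w - g a w' : ℝ) : 𝕜) + ((h a w - h a w' : ℝ) : 𝕜) * RCLike.I := by
      simp only [G]; push_cast; ring
    have h1 := (hg a).dist_le_mul w w'
    have h2 := (hh a).dist_le_mul w w'
    rw [Real.dist_eq, NNReal.coe_one, one_mul] at h1 h2
    calc _ ≤ |g a w - g a w'| + |h a w - h a w'| * 1 := by
          rw [e]
          refine (norm_add_le _ _).trans ?_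
          rw [norm_mul, RCLike.norm_ofReal, RCLike.norm_ofReal]
          gcongr
          rw [RCLike.norm_I]
          split_ifs <;> norm_num
      _ ≤ _ := by linarith
  -- `G` vanishes at `i 0`, so the uniform Lipschitz bound makes `G w` bounded.
  have hGm : ∀ w, Memℓp (G w) ∞ := fun w => memℓp_infty ⟨2 * dist w (i 0), by
    rintro _ ⟨a, rfl⟩
    simpa [hGi] using hGd w (i 0) a⟩
  refine ⟨2, fun w => ⟨G w, hGm w⟩, LipschitzWith.of_dist_le_mul fun w w' => ?_, fun y => ?_⟩
  · rw [dist_eq_norm]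
    exact lp.norm_le_of_forall_le (by positivity) fun a => hGd w w' a
  · ext a
    exact hGi y a

/-! ### Norms in `L_p` and the summing property. -/

theorem norm_toLp_rpow {𝕜 K : Type*} [RCLike 𝕜] [TopologicalSpace K] [CompactSpace K]
    [MeasurableSpace K] [BorelSpace K] {p : ℝ≥0∞} [Fact (1 ≤ p)] (hp : p ≠ ∞) (μ : Measure K)
    [IsFiniteMeasure μ] (f : C(K, 𝕜)) :
    ‖ContinuousMap.toLp p μ 𝕜 f‖ ^ p.toReal = ∫ φ, ‖f φ‖ ^ p.toReal ∂μ := by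
  have hp0 : p ≠ 0 := (zero_lt_one.trans_le Fact.out).ne'
  have hpr : 0 < p.toReal := ENNReal.toReal_pos hp0 hp
  have hm := Lp.memLp (ContinuousMap.toLp p μ 𝕜 f)
  have hi : 0 ≤ ∫ φ, ‖f φ‖ ^ p.toReal ∂μ := integral_nonneg fun φ => by positivity
  have : ∫ φ, ‖ContinuousMap.toLp p μ 𝕜 f φ‖ ^ p.toReal ∂μ = ∫ φ, ‖f φ‖ ^ p.toReal ∂μ := by
    refine integral_congr_ae ?_
    filter_upwards [ContinuousMap.coeFn_toLp (p := p) (𝕜 := 𝕜) μ f] with φ hφ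
    rw [hφ]
  rw [Lp.norm_def, hm.eLpNorm_eq_integral_rpow_norm hp0 hp, this,
    ENNReal.toReal_ofReal (by positivity), Real.rpow_inv_rpow hi hpr.ne']

theorem integrable_norm_rpow {𝕜 K : Type*} [RCLike 𝕜] [TopologicalSpace K] [CompactSpace K]
    [MeasurableSpace K] [BorelSpace K] (μ : Measure K) [IsFiniteMeasure μ] (f : C(K, 𝕜))
    {r : ℝ} (hr : 0 ≤ r) : Integrable (fun φ => ‖f φ‖ ^ r) μ :=
  (f.continuous.norm.rpow_const fun _ => Or.inr hr).integrable_of_hasCompactSupport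
    (HasCompactSupport.of_compactSpace _)

/-- A map that is Lipschitz with respect to the `L_p(μ)` metric induced by `Ψ` is `Ψ`-Lipschitz
`p`-summing. -/
theorem isLipschitzSumming_of_dist_le {𝕜 X Y K : Type*} [RCLike 𝕜] [MetricSpace Y]
    [TopologicalSpace K] [CompactSpace K] [MeasurableSpace K] [BorelSpace K]
    {p : ℝ≥0∞} [Fact (1 ≤ p)] (hp : p ≠ ∞) (μ : Measure K) [IsProbabilityMeasure μ]
    {Ψ : X → C(K, 𝕜)} {u : X → Y} {C : ℝ} (hC : 0 ≤ C)
    (h : ∀ x y, dist (u x) (u y) ≤ C * ‖ContinuousMap.toLp p μ 𝕜 (Ψ x - Ψ y)‖) :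
    IsLipschitzSumming Ψ p u := by
  have hpr : 0 < p.toReal := ENNReal.toReal_pos (zero_lt_one.trans_le Fact.out).ne' hp
  refine ⟨C, hC, fun m x q => ?_⟩
  set F : K → ℝ := fun φ => (∑ j, ‖Ψ (x j) φ - Ψ (q j) φ‖ ^ p.toReal) ^ (1 / p.toReal) with hF
  have hFc : Continuous F := by
    refine Continuous.rpow_const (continuous_finsetSum _ fun j _ =>
      Continuous.rpow_const (by fun_prop) fun _ => Or.inr hpr.le) fun _ => Or.inr (by positivity)
  -- Without boundedness the real supremum would take the default value 0.
  have hb : BddAbove (Set.range F) := (isCompact_range hFc).bddAbove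
  have hF0 : ∀ φ, 0 ≤ F φ := fun φ => by positivity
  have hS0 : 0 ≤ ⨆ φ, F φ := Real.iSup_nonneg hF0
  have key : ∑ j, dist (u (x j)) (u (q j)) ^ p.toReal ≤ (C * ⨆ φ, F φ) ^ p.toReal := by
    calc _ ≤ ∑ j, (C ^ p.toReal * ∫ φ, ‖(Ψ (x j) - Ψ (q j)) φ‖ ^ p.toReal ∂μ) := by
          refine Finset.sum_le_sum fun j _ => ?_
          rw [← norm_toLp_rpow hp, ← Real.mul_rpow hC (norm_nonneg _)]
          exact Real.rpow_le_rpow dist_nonneg (h _ _) hpr.le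
      _ = C ^ p.toReal * ∫ φ, ∑ j, ‖(Ψ (x j) - Ψ (q j)) φ‖ ^ p.toReal ∂μ := by
          rw [← Finset.mul_sum, integral_finsetSum]
          exact fun j _ => integrable_norm_rpow μ _ hpr.le
      -- The total mass is one, so an average is bounded by the supremum.
      _ ≤ C ^ p.toReal * ∫ _, (⨆ φ, F φ) ^ p.toReal ∂μ := by
          refine mul_le_mul_of_nonneg_left (integral_mono (integrable_finsetSum _ fun j _ =>
            integrable_norm_rpow μ _ hpr.le) (integrable_const _) fun φ => ?_) (by positivity)
          have := Real.rpow_le_rpow (hF0 φ) (le_ciSup hb φ) hpr.le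
          refine le_trans (le_of_eq ?_) this
          simp only [hF, ContinuousMap.sub_apply]
          rw [one_div, Real.rpow_inv_rpow (by positivity) hpr.ne']
      _ = _ := by
          rw [integral_const, probReal_univ, one_smul, Real.mul_rpow hC hS0]
  calc _ ≤ ((C * ⨆ φ, F φ) ^ p.toReal) ^ (1 / p.toReal) :=
        Real.rpow_le_rpow (by positivity) key (by positivity)
    _ = _ := by rw [one_div, Real.rpow_rpow_inv (by positivity) hpr.ne']

/-! ### Signed sums that are small in `L_p`. -/

/-- The sign `1` or `-1` coded by a Boolean. -/
def boolSign (b : Bool) : ℝ := if b then 1 else -1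

theorem boolSign_sq (b : Bool) : boolSign b ^ 2 = 1 := by
  cases b <;> simp [boolSign]

theorem abs_boolSign (b : Bool) : |boolSign b| = 1 := by
  cases b <;> simp [boolSign]

theorem exists_boolSign_mul_nonpos (c : ℝ) : ∃ b, boolSign b * c ≤ 0 := by
  rcases le_total c 0 with h | h
  · exact ⟨true, by simpa [boolSign] using h⟩
  · exact ⟨false, by simpa [boolSign] using h⟩

/-- Greedy choice: one of the two signs makes the cross term with the previous sum nonpositive, so
each new function adds at most `∫ f ^ 2 ≤ 1`. -/
theorem exists_signs_integral_sq_le {K : Type*} [TopologicalSpace K] [CompactSpace K]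
    [MeasurableSpace K] [BorelSpace K] (μ : Measure K) [IsProbabilityMeasure μ]
    (f : ℕ → C(K, ℝ)) (hf : ∀ n φ, |f n φ| ≤ 1) (N : ℕ) :
    ∃ s : ℕ → Bool, ∫ φ, (∑ n ∈ Finset.range N, boolSign (s n) * f n φ) ^ 2 ∂μ ≤ N := by
  have hint : ∀ g : C(K, ℝ), Integrable (fun φ => g φ) μ := fun g =>
    g.continuous.integrable_of_hasCompactSupport (HasCompactSupport.of_compactSpace _)
  induction N with
  | zero => exact ⟨fun _ => true, by simp⟩
  | succ N ih =>
    obtain ⟨s, hs⟩ := ih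
    let g : C(K, ℝ) := ∑ n ∈ Finset.range N, boolSign (s n) • f n
    have hg : ∀ φ, g φ = ∑ n ∈ Finset.range N, boolSign (s n) * f n φ := fun φ => by
      simp [g, ContinuousMap.sum_apply]
    obtain ⟨b, hb⟩ := exists_boolSign_mul_nonpos (∫ φ, (g * f N) φ ∂μ)
    refine ⟨Function.update s N b, ?_⟩
    have e : ∀ φ, (∑ n ∈ Finset.range (N + 1), boolSign (Function.update s N b n) * f n φ) ^ 2 =
        (g ^ 2) φ + (2 * boolSign b) * (g * f N) φ + (f N ^ 2) φ := fun φ => by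
      rw [Finset.sum_range_succ, Function.update_self, Finset.sum_congr rfl fun n hn => by
        rw [Function.update_of_ne (Finset.mem_range.1 hn).ne], ← hg]
      simp only [ContinuousMap.mul_apply, ContinuousMap.pow_apply]
      linear_combination (f N φ) ^ 2 * boolSign_sq b
    have hN : ∫ φ, (f N ^ 2) φ ∂μ ≤ 1 := by
      calc _ ≤ ∫ _, (1 : ℝ) ∂μ := integral_mono (hint _) (integrable_const _) fun φ => by
            simpa using hf N φ
        _ = 1 := by simp
    have hs' : ∫ φ, (g ^ 2) φ ∂μ ≤ N := by simpa [hg] using hs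
    simp_rw [e]
    rw [integral_add (f := fun φ => (g ^ 2) φ + (2 * boolSign b) * (g * f N) φ)
        ((hint _).add ((hint _).const_mul _)) (hint _),
      integral_add (hint _) ((hint _).const_mul _), integral_const_mul]
    rw [Nat.cast_succ]
    linarith

/-- A combination of `M ^ 2` functions bounded by one, with suitable signs, is small in `L_p`. -/
theorem exists_signs_norm_toLp_le {𝕜 K : Type*} [RCLike 𝕜] [TopologicalSpace K] [CompactSpace K]
    [MeasurableSpace K] [BorelSpace K] {p : ℝ≥0∞} [Fact (1 ≤ p)] (hp : p ≠ ∞) (μ : Measure K)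
    [IsProbabilityMeasure μ] (Φ : ℕ → C(K, 𝕜)) (f : ℕ → C(K, ℝ))
    (hΦ : ∀ n φ, Φ n φ = (f n φ : 𝕜)) (hf : ∀ n φ, |f n φ| ≤ 1) {M : ℕ} (hM : 0 < M) :
    ∃ s : ℕ → Bool,
      ‖ContinuousMap.toLp p μ 𝕜
        (∑ n ∈ Finset.range (M ^ 2), ((boolSign (s n) : ℝ) : 𝕜) • Φ n)‖ ^ p.toReal ≤
        ((M : ℝ) ^ 2) ^ p.toReal / M := by
  obtain ⟨s, hs⟩ := exists_signs_integral_sq_le μ f hf (M ^ 2)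
  refine ⟨s, ?_⟩
  have hp1 : 1 ≤ p.toReal := by
    simpa using ENNReal.toReal_mono hp (Fact.out : 1 ≤ p)
  have hM' : (0 : ℝ) < M := by exact_mod_cast hM
  let g : C(K, ℝ) := ∑ n ∈ Finset.range (M ^ 2), boolSign (s n) • f n
  have hg : ∀ φ, g φ = ∑ n ∈ Finset.range (M ^ 2), boolSign (s n) * f n φ := fun φ => by
    simp [g, ContinuousMap.sum_apply]
  have hG : ∀ φ, ‖(∑ n ∈ Finset.range (M ^ 2), ((boolSign (s n) : ℝ) : 𝕜) • Φ n) φ‖ = |g φ| :=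
    fun φ => by
      rw [← RCLike.norm_ofReal (K := 𝕜), hg]
      simp [ContinuousMap.sum_apply, hΦ]
  have hgb : ∀ φ, |g φ| ≤ (M : ℝ) ^ 2 := fun φ => by
    rw [hg]
    refine (Finset.abs_sum_le_sum_abs _ _).trans
      ((Finset.sum_le_card_nsmul _ _ 1 fun n _ => ?_).trans ?_)
    · rw [abs_mul, abs_boolSign, one_mul]; exact hf n φ
    · simp
  -- With `t = |g| / M ^ 2 ∈ [0, 1]`, one has `t ^ p ≤ t ≤ (1 + (M t) ^ 2) / (2 M)`, the latter from
  -- `(M t - 1) ^ 2 ≥ 0`. This reduces every `p` to the `L_2` bound.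
  have hpt : ∀ φ, |g φ| ^ p.toReal ≤
      ((M : ℝ) ^ 2) ^ p.toReal / (2 * M) * (1 + (g ^ 2) φ / (M : ℝ) ^ 2) := fun φ => by
    set t := |g φ| / (M : ℝ) ^ 2 with ht
    have ht0 : 0 ≤ t := by positivity
    have ht1 : t ≤ 1 := (div_le_one (by positivity)).2 (hgb φ)
    have hgt : |g φ| = (M : ℝ) ^ 2 * t := by rw [ht]; field_simp
    have hgt2 : (g ^ 2) φ = ((M : ℝ) ^ 2 * t) ^ 2 := by
      rw [ContinuousMap.pow_apply, ← sq_abs, hgt]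
    have h1 : t ^ p.toReal ≤ t := by
      simpa using Real.rpow_le_rpow_of_exponent_ge' ht0 ht1 zero_le_one hp1
    rw [hgt, hgt2, Real.mul_rpow (by positivity) ht0, div_mul_eq_mul_div, mul_div_assoc]
    refine mul_le_mul_of_nonneg_left (h1.trans ?_) (by positivity)
    rw [le_div_iff₀ (by positivity)]
    have : ((M : ℝ) ^ 2 * t) ^ 2 / (M : ℝ) ^ 2 = (M * t) ^ 2 := by field_simp
    rw [this]
    nlinarith [sq_nonneg ((M : ℝ) * t - 1)]
  have hint : Integrable (fun φ => (g ^ 2) φ) μ :=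
    (g ^ 2).continuous.integrable_of_hasCompactSupport (HasCompactSupport.of_compactSpace _)
  have hs' : ∫ φ, (g ^ 2) φ ∂μ ≤ (M : ℝ) ^ 2 := by simpa [hg] using hs
  rw [norm_toLp_rpow hp]
  simp_rw [hG]
  calc _ ≤ ∫ φ, ((M : ℝ) ^ 2) ^ p.toReal / (2 * M) * (1 + (g ^ 2) φ / (M : ℝ) ^ 2) ∂μ :=
        integral_mono (integrable_norm_rpow μ g (by positivity))
          (((integrable_const _).add (hint.div_const _)).const_mul _) hpt
    _ = ((M : ℝ) ^ 2) ^ p.toReal / (2 * M) * (1 + (∫ φ, (g ^ 2) φ ∂μ) / (M : ℝ) ^ 2) := by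
        rw [integral_const_mul, integral_add (integrable_const _) (hint.div_const _),
          integral_div, integral_const, probReal_univ, one_smul]
    _ ≤ ((M : ℝ) ^ 2) ^ p.toReal / (2 * M) * (1 + 1) := by
        gcongr
        exact (div_le_one (by positivity)).2 hs'
    _ = _ := by field_simp; ring

/-! ### The discrete space and the coin-flip measure. -/

/-- The metric on `Option ℕ` in which any two distinct points have distance one. -/
instance discreteMetricOptionNat : MetricSpace (Option ℕ) where
  dist x y := if x = y then 0 else 1
  dist_self x := by simp
  dist_comm x y := by simp only [eq_comm]
  dist_triangle x y z := by
    by_cases h : x = y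
    · subst h; simp
    · by_cases h' : x = z <;> by_cases h'' : y = z <;> simp_all
  eq_of_dist_eq_zero := by
    intro x y h
    by_contra hne
    simp [hne] at h

theorem dist_optionNat (x y : Option ℕ) : dist x y = if x = y then 0 else 1 := rfl

theorem LipBall.abs_apply_le_one (φ : LipBall (none : Option ℕ)) (x : Option ℕ) :
    |φ.1 x| ≤ 1 := by
  have := φ.2.1.dist_le_mul x none
  rw [φ.2.2, Real.dist_eq, sub_zero, NNReal.coe_one, one_mul, dist_optionNat] at this
  refine this.trans ?_
  split_ifs <;> norm_num

/-- The function that vanishes at `none` and is given by a sequence of coin flips elsewhere. -/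
def coinFlip (ε : ℕ → Bool) : LipBall (none : Option ℕ) :=
  ⟨fun x => x.elim 0 fun n => if ε n then 1 else 0, LipschitzWith.of_dist_le_mul fun x y => by
    rw [dist_optionNat, Real.dist_eq, NNReal.coe_one, one_mul]
    by_cases h : x = y
    · simp [h]
    · rw [if_neg h]
      have h01 : ∀ z : Option ℕ, 0 ≤ z.elim (0 : ℝ) (fun n => if ε n then 1 else 0) ∧
          z.elim (0 : ℝ) (fun n => if ε n then 1 else 0) ≤ 1 := by
        rintro (_ | n)
        · simp
        · simp only [Option.elim]
          split_ifs <;> norm_num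
      exact abs_sub_le_iff.2 ⟨by linarith [h01 x, h01 y], by linarith [h01 x, h01 y]⟩, rfl⟩

theorem continuous_coinFlip : Continuous coinFlip := by
  refine Continuous.subtype_mk (continuous_pi fun x => ?_) _
  rcases x with _ | n
  · exact continuous_const
  · exact (continuous_of_discreteTopology (f := fun b : Bool => if b then (1 : ℝ) else 0)).comp
      (continuous_apply n)

/-- The law of a sequence of independent fair coin flips. -/
noncomputable def coinMeasure : Measure (ℕ → Bool) :=
  Measure.infinitePi fun _ => (PMF.uniformOfFintype Bool).toMeasure

instance : IsProbabilityMeasure coinMeasure :=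
  inferInstanceAs (IsProbabilityMeasure (Measure.infinitePi _))

theorem coinMeasure_pi (s : Finset ℕ) (b : ℕ → Bool) :
    coinMeasure {ε | ∀ n ∈ s, ε n = b n} = 2⁻¹ ^ s.card := by
  have : {ε : ℕ → Bool | ∀ n ∈ s, ε n = b n} = Set.pi s fun n => {b n} := by
    ext ε; simp
  rw [this, coinMeasure, Measure.infinitePi_pi _ fun _ _ => measurableSet_singleton _]
  simp

/-- The law of the random function `coinFlip`. -/
noncomputable def flipMeasure : Measure (LipBall (none : Option ℕ)) :=
  coinMeasure.map coinFlip

instance : IsProbabilityMeasure flipMeasure :=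
  Measure.isProbabilityMeasure_map continuous_coinFlip.measurable.aemeasurable

/-- `Option ℕ` is countable, so pointwise convergence is metrizable and regularity of the finite
measure is automatic. -/
instance : flipMeasure.Regular := by
  have : TopologicalSpace.PseudoMetrizableSpace (LipBall (none : Option ℕ)) :=
    (Topology.IsInducing.subtypeVal (t := {f : Option ℕ → ℝ |
      LipschitzWith 1 f ∧ f none = 0})).pseudoMetrizableSpace
  infer_instance

/-- With probability at least 1/4 the flip is heads at one point and tails at the other (or just
heads, if the other is the base point); there the evaluations differ by 1. -/
theorem one_le_norm_toLp_lipEval_sub (𝕜 : Type*) [RCLike 𝕜] {p : ℝ≥0∞} [Fact (1 ≤ p)]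
    (hp : p ≠ ∞) {x y : Option ℕ} (hxy : x ≠ y) :
    1 ≤ 4 * ‖ContinuousMap.toLp p flipMeasure 𝕜 (lipEval 𝕜 none x - lipEval 𝕜 none y)‖ := by
  wlog hx : x ≠ none generalizing x y
  · rw [← neg_sub, map_neg, norm_neg]
    exact this hxy.symm fun hy => hx (by rw [hy] at hxy; exact hxy)
  obtain ⟨n, rfl⟩ := Option.ne_none_iff_exists'.1 hx
  have hp1 : 1 ≤ p.toReal := by
    simpa using ENNReal.toReal_mono hp (Fact.out : 1 ≤ p)
  set c := ‖ContinuousMap.toLp p flipMeasure 𝕜 (lipEval 𝕜 none (some n) - lipEval 𝕜 none y)‖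
  obtain ⟨S, hS, hSm, hS1⟩ : ∃ S : Set (ℕ → Bool), 1 / 4 ≤ coinMeasure.real S ∧
      MeasurableSet S ∧ ∀ ε ∈ S, (coinFlip ε).1 (some n) - (coinFlip ε).1 y = 1 := by
    rcases y with _ | m
    · refine ⟨{ε | ∀ k ∈ ({n} : Finset ℕ), ε k = true}, ?_, ?_, fun ε hε => ?_⟩
      · rw [measureReal_def, coinMeasure_pi _ fun _ => true]
        norm_num
      · measurability
      · have : ε n = true := hε n (by simp)
        simp [coinFlip, this]
    · have hnm : m ≠ n := fun h => hxy (by rw [h])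
      refine ⟨{ε | ∀ k ∈ ({n, m} : Finset ℕ), ε k = decide (k = n)}, ?_, ?_, fun ε hε => ?_⟩
      · rw [measureReal_def, coinMeasure_pi _ fun k => decide (k = n), Finset.card_pair hnm.symm]
        norm_num
      · measurability
      · have h1 : ε n = true := by simpa using hε n (by simp)
        have h2 : ε m = false := by simpa [hnm] using hε m (by simp)
        simp [coinFlip, h1, h2]
  have hc : 1 / 4 ≤ c ^ p.toReal := by
    rw [norm_toLp_rpow hp, flipMeasure, integral_map continuous_coinFlip.measurable.aemeasurable
      (integrable_norm_rpow _ _ (by positivity)).aestronglyMeasurable]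
    refine hS.trans ?_
    rw [← integral_indicator_one hSm]
    refine integral_mono ((integrable_const 1).indicator hSm)
      ((integrable_map_measure (integrable_norm_rpow _ _ (by positivity)).aestronglyMeasurable
        continuous_coinFlip.measurable.aemeasurable).1
        (integrable_norm_rpow _ _ (by positivity))) fun ε => ?_
    by_cases hε : ε ∈ S
    · have : ‖(lipEval 𝕜 none (some n) - lipEval 𝕜 none y) (coinFlip ε)‖ = 1 := by
        rw [ContinuousMap.sub_apply]
        change ‖((_ : ℝ) : 𝕜) - ((_ : ℝ) : 𝕜)‖ = 1
        rw [← RCLike.ofReal_sub, hS1 ε hε]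
        simp
      simp only [Set.indicator_of_mem hε, this]
      simp
    · simp only [Set.indicator_of_notMem hε]
      positivity
  -- If `c < 1/4`, then `c ^ p ≤ c < 1/4` because `1 ≤ p`; so the constant 4 serves every `p`.
  by_contra! hlt
  have h0 : 0 ≤ c := norm_nonneg _
  have : c ^ p.toReal ≤ c := by
    simpa using Real.rpow_le_rpow_of_exponent_ge' h0 (by linarith) zero_le_one hp1
  linarith

/-! ### Sign functions in ℓ∞. -/

/-- The bounded function `ε ↦ ± 1` on sign sequences given by the `n`-th sign. -/
noncomputable def signVec (𝕜 : Type*) [RCLike 𝕜] (n : ℕ) : lp (fun _ : ℕ → Bool => 𝕜) ∞ :=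
  ⟨fun ε => (boolSign (ε n) : 𝕜), memℓp_infty ⟨1, by
    rintro _ ⟨ε, rfl⟩
    simp [abs_boolSign]⟩⟩

theorem norm_signVec_le (𝕜 : Type*) [RCLike 𝕜] (n : ℕ) : ‖signVec 𝕜 n‖ ≤ 1 :=
  lp.norm_le_of_forall_le zero_le_one fun ε => by simp [signVec, abs_boolSign]

/-- At the coordinate indexed by `s` itself every summand equals 1. -/
theorem le_norm_sum_signVec (𝕜 : Type*) [RCLike 𝕜] (s : ℕ → Bool) (N : ℕ) :
    N ≤ ‖∑ n ∈ Finset.range N, ((boolSign (s n) : ℝ) : 𝕜) • signVec 𝕜 n‖ := by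
  refine le_trans ?_ (lp.norm_apply_le_norm ENNReal.top_ne_zero _ s)
  rw [lp.coeFn_sum, Finset.sum_apply, Finset.sum_congr rfl (g := fun _ => (1 : 𝕜)) fun n _ => ?_]
  · simp
  · change (boolSign (s n) : 𝕜) * (boolSign (s n) : 𝕜) = 1
    rw [← sq, ← RCLike.ofReal_pow, boolSign_sq, RCLike.ofReal_one]

/-- The map sending the base point to zero and the other points to the sign functions. -/
noncomputable def signMap (𝕜 : Type*) [RCLike 𝕜] (x : Option ℕ) :
    lp (fun _ : ℕ → Bool => 𝕜) ∞ :=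
  x.elim 0 (signVec 𝕜)

/-- The values lie in the unit ball, hence at most 2 apart, and `8 = 2 * 4`. -/
theorem dist_signMap_le (𝕜 : Type*) [RCLike 𝕜] {p : ℝ≥0∞} [Fact (1 ≤ p)] (hp : p ≠ ∞)
    (x y : Option ℕ) : dist (signMap 𝕜 x) (signMap 𝕜 y) ≤
      8 * ‖ContinuousMap.toLp p flipMeasure 𝕜 (lipEval 𝕜 none x - lipEval 𝕜 none y)‖ := by
  by_cases hxy : x = y
  · simp [hxy]
  · have h1 : ∀ x, ‖signMap 𝕜 x‖ ≤ 1 := by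
      rintro (_ | n)
      · simp [signMap]
      · exact norm_signVec_le 𝕜 n
    have h := one_le_norm_toLp_lipEval_sub 𝕜 hp hxy
    have := dist_le_norm_add_norm (signMap 𝕜 x) (signMap 𝕜 y)
    linarith [h1 x, h1 y]

/-! ### Lipschitz factorization and failure of linear factorization. -/

theorem exists_lipschitz_closesDiagram {𝕜 X Y Z K : Type*} [RCLike 𝕜] [TopologicalSpace K]
    [CompactSpace K] [MeasurableSpace K] [BorelSpace K] [MetricSpace Y] [MetricSpace Z]
    [Nonempty Z] {p : ℝ≥0∞} [Fact (1 ≤ p)] (μ : Measure K) [IsFiniteMeasure μ]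
    {Ψ : X → C(K, 𝕜)} {u : X → Y} {C : ℝ≥0}
    (h : ∀ x y, dist (u x) (u y) ≤ C * ‖ContinuousMap.toLp p μ 𝕜 (Ψ x - Ψ y)‖)
    (hZ : IsAbsoluteLipschitzRetract Z) {J : Y → Z} (hJ : Isometry J) :
    ∃ B : Lp 𝕜 p μ → Z, (∃ C : ℝ≥0, LipschitzWith C B) ∧ ClosesDiagram Ψ p μ u J B := by
  obtain ⟨z₀⟩ := ‹Nonempty Z›
  set Φ : X → Lp 𝕜 p μ := fun x => ContinuousMap.toLp p μ 𝕜 (Ψ x) with hΦ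
  have hd : ∀ x y, dist (J (u x)) (J (u y)) ≤ C * dist (Φ x) (Φ y) := fun x y => by
    rw [hJ.dist_eq, dist_eq_norm (Φ x), hΦ, ← map_sub]
    exact h x y
  -- Points identified in `L_p` have equal images, so `J ∘ u` descends to the range of `Φ`, from
  -- which it is extended.
  have hfac : Function.FactorsThrough (J ∘ u) Φ := fun x y hxy => by
    have := hd x y
    rw [hxy, dist_self, mul_zero] at this
    exact dist_le_zero.1 this
  have hL : LipschitzOnWith C (Function.extend Φ (J ∘ u) fun _ => z₀) (Set.range Φ) := by
    refine LipschitzOnWith.of_dist_le_mul ?_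
    rintro _ ⟨x, rfl⟩ _ ⟨y, rfl⟩
    rw [hfac.extend_apply, hfac.extend_apply]
    exact hd x y
  have : Nonempty Z := ⟨z₀⟩
  obtain ⟨B, hB, hBs⟩ := hZ.exists_extension hL
  refine ⟨B, hB, fun x => ?_⟩
  rw [← hBs ⟨x, rfl⟩, hfac.extend_apply]
  rfl

theorem not_exists_linear_closesDiagram {𝕜 Z : Type*} [RCLike 𝕜] [NormedAddCommGroup Z]
    [NormedSpace 𝕜 Z] {p : ℝ≥0∞} [Fact (1 ≤ p)] (hp : p ≠ ∞)
    (J : lp (fun _ : ℕ → Bool => 𝕜) ∞ →ₗᵢ[𝕜] Z) (μ : Measure (LipBall (none : Option ℕ)))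
    [IsProbabilityMeasure μ] :
    ¬ ∃ B : Lp 𝕜 p μ → Z, (∃ C : ℝ≥0, LipschitzWith C B) ∧ IsLinearMap 𝕜 B ∧
      ClosesDiagram (lipEval 𝕜 none) p μ (signMap 𝕜) J B := by
  rintro ⟨B, ⟨C, hC⟩, hlin, hB⟩
  have hpr : 0 < p.toReal := ENNReal.toReal_pos (zero_lt_one.trans_le Fact.out).ne' hp
  -- Comparing both norms of the signed sum of `M ^ 2` terms will force `M ≤ C ^ p`.
  obtain ⟨M, hM⟩ := exists_nat_gt ((C : ℝ) ^ p.toReal)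
  have hM0 : (0 : ℝ) < M := lt_of_le_of_lt (by positivity) hM
  obtain ⟨s, hs⟩ := exists_signs_norm_toLp_le hp μ (fun n => lipEval 𝕜 none (some n))
    (fun n => lipEval ℝ none (some n)) (fun _ _ => rfl)
    (fun n φ => φ.abs_apply_le_one (some n)) (by exact_mod_cast hM0)
  set g : C(LipBall (none : Option ℕ), 𝕜) :=
    ∑ n ∈ Finset.range (M ^ 2), ((boolSign (s n) : ℝ) : 𝕜) • lipEval 𝕜 none (some n) with hg
  have hBg : B (ContinuousMap.toLp p μ 𝕜 g) =
      J (∑ n ∈ Finset.range (M ^ 2), ((boolSign (s n) : ℝ) : 𝕜) • signVec 𝕜 n) := by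
    rw [hg, map_sum, map_sum]
    refine (map_sum (hlin.mk' B) _ _).trans (Finset.sum_congr rfl fun n _ => ?_)
    rw [map_smul, map_smul, map_smul]
    exact congrArg _ (hB (some n))
  have hle : (M : ℝ) ^ 2 ≤ C * ‖ContinuousMap.toLp p μ 𝕜 g‖ := by
    have h1 := hC.dist_le_mul (ContinuousMap.toLp p μ 𝕜 g) 0
    rw [hlin.map_zero, dist_zero_right, dist_zero_right, hBg, J.norm_map] at h1
    refine le_trans ?_ h1
    exact_mod_cast le_norm_sum_signVec 𝕜 s (M ^ 2)
  have h2 := Real.rpow_le_rpow (by positivity) hle hpr.le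
  rw [Real.mul_rpow C.coe_nonneg (norm_nonneg _)] at h2
  have h3 : ((M : ℝ) ^ 2) ^ p.toReal ≤ (C : ℝ) ^ p.toReal * (((M : ℝ) ^ 2) ^ p.toReal / M) :=
    h2.trans (mul_le_mul_of_nonneg_left hs (by positivity))
  rw [mul_div_assoc', le_div_iff₀ hM0, mul_comm] at h3
  exact absurd (le_of_mul_le_mul_right h3 (by positivity)) hM.not_ge

theorem mainTheorem3 (𝕜 : Type) [RCLike 𝕜] (p : ℝ≥0∞) [Fact (1 ≤ p)] (hp : p ≠ ∞) :
    ∃ (X : Type) (_ : MetricSpace X) (x₀ : X)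
      (Y : Type) (_ : NormedAddCommGroup Y) (_ : NormedSpace 𝕜 Y) (_ : CompleteSpace Y)
      (u : X → Y),
      u x₀ = 0 ∧
      IsLipschitzSumming (lipEval 𝕜 x₀) p u ∧
      (∃ (Z : Type) (_ : NormedAddCommGroup Z) (_ : NormedSpace 𝕜 Z) (_ : CompleteSpace Z),
        IsAbsoluteLipschitzRetract Z ∧ Nonempty (Y →ₗᵢ[𝕜] Z)) ∧
      ∃ (μ₀ : Measure (LipBall x₀)) (_ : IsProbabilityMeasure μ₀) (_ : μ₀.Regular),
        ∀ (Z : Type*) [NormedAddCommGroup Z] [NormedSpace 𝕜 Z] [CompleteSpace Z],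
          IsAbsoluteLipschitzRetract Z → ∀ J : Y →ₗᵢ[𝕜] Z,
            (∃ B : Lp 𝕜 p μ₀ → Z, (∃ C : ℝ≥0, LipschitzWith C B) ∧
              ClosesDiagram (lipEval 𝕜 x₀) p μ₀ u J B) ∧
            ∀ (μ : Measure (LipBall x₀)) [IsProbabilityMeasure μ] [μ.Regular],
              ¬ ∃ B : Lp 𝕜 p μ → Z, (∃ C : ℝ≥0, LipschitzWith C B) ∧ IsLinearMap 𝕜 B ∧
                ClosesDiagram (lipEval 𝕜 x₀) p μ u J B := by
  have h8 : (0 : ℝ) ≤ 8 := by norm_num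
  refine ⟨Option ℕ, inferInstance, none, lp (fun _ : ℕ → Bool => 𝕜) ∞, inferInstance,
    inferInstance, inferInstance, signMap 𝕜, rfl,
    isLipschitzSumming_of_dist_le hp flipMeasure h8 (dist_signMap_le 𝕜 hp),
    -- The space `Y` is itself an absolute Lipschitz retract.
    ⟨lp (fun _ : ℕ → Bool => 𝕜) ∞, inferInstance, inferInstance, inferInstance,
      isAbsoluteLipschitzRetract_lp_infty, ⟨LinearIsometry.id⟩⟩,
    flipMeasure, inferInstance, inferInstance, fun Z _ _ _ hZ J => ⟨?_, fun μ _ _ => ?_⟩⟩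
  · exact exists_lipschitz_closesDiagram (C := 8) flipMeasure (dist_signMap_le 𝕜 hp) hZ J.isometry
  · exact not_exists_linear_closesDiagram hp J μ
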